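/- A graph on node set $[n]$ is $d$-bounded if all its degrees are at most $d$; two graphs on $[n]$ are node neighbors if they differ only in edges incident to a single node. A (noninteractive) algorithm $\mathcal A$ on graphs with node set $[n]$ draws public randomness $\rho$, lets every node $i$ release a report $\mathcal R_{i,\rho}(N_i^G)$ that depends only on $\rho$, on its neighborhood $N_i^G$ and on its own independent coins, and outputs a real number obtained by (possibly randomized) postprocessing of the vector of reports. For $\varepsilon>0$ and $\delta\ge 0$, it is $(\varepsilon,\delta)$-LNDP (locally node differentially private) if, for every fixed $\rho$ and all node-neighboring $G,G'$, the distributions $P,Q$ of the report vectors on $G$ and $G'$ satisfy $P(S)\le e^{\varepsilon}Q(S)+\delta$ and $Q(S)\le e^{\varepsilon}P(S)+\delta$ for every event $S$. **Theorem (error for private edge counting).** There exist absolute constants $c>0$, $c'>0$ and $n_0\in\mathbb N$ such that, for all $\varepsilon>0$ and $\delta$ with $0\le\delta\le\varepsilon\le c$, all integers $n\ge n_0$, every $(\varepsilon,\delta)$-LNDP algorithm $\mathcal A$ on graphs with node set $[n]$, and every real $\alpha$, the following holds. 1. For every integer $d\ge 1$ with $d\le c/\varepsilon$: if $\Pr\big[\,|\mathcal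 A(G)-|E(G)||\le\alpha\,\big]\ge\frac23$ for every $d$-bounded graph $G$ on $[n]$, then $$\alpha\ \ge\ \frac12\min\Big\{\Big\lfloor\frac{dn}{2}\Big\rfloor,\binom n2\Big\}.$$ 2. For $d=\lfloor\min\{c/\varepsilon,\,n-1\}\rfloor$: if $\Pr\big[\,|\mathcal A(G)-|E(G)||\le\alpha\,\big]\ge\frac23$ for every $d$-bounded graph $G$ on $[n]$, then $\alpha\ge c'\min\{n/\varepsilon,\,n^2\}$. -/

import Mathlib

open MeasureTheory ProbabilityTheory
open scoped ENNReal

universe u v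

/-- Two graphs on the same node set are node neighbors if they differ only in the set of edges
incident to some single node `i`. -/
def NodeNeighbors {n : ℕ} (G G' : SimpleGraph (Fin n)) : Prop :=
  ∃ i : Fin n, ∀ u v : Fin n, u ≠ i → v ≠ i → (G.Adj u v ↔ G'.Adj u v)

/-- A graph is `d`-bounded if every node has degree at most `d`. -/
def DegreeBounded {n : ℕ} (d : ℕ) (G : SimpleGraph (Fin n)) : Prop :=
  ∀ v : Fin n, (G.neighborSet v).ncard ≤ d

/-- `(ε, δ)`-indistinguishability of two distributions. -/
def Indistinguishable {Y : Type*} [MeasurableSpace Y] (ε δ : ℝ) (μ ν : Measure Y) : Prop :=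
  ∀ S : Set Y, MeasurableSet S →
    μ S ≤ ENNReal.ofReal (Real.exp ε) * ν S + ENNReal.ofReal δ ∧
    ν S ≤ ENNReal.ofReal (Real.exp ε) * μ S + ENNReal.ofReal δ

/-- A noninteractive local algorithm on graphs with node set `Fin n`, with real-valued output.
Public randomness `ρ` is drawn from `publicDist`; node `i` with neighborhood `S` releases a report
with distribution `randomizer i S ρ`; the (randomized) postprocessing `post` is applied to the
vector of all reports. -/
structure LocalAlgorithm (n : ℕ) where
  /-- The space of public random strings. -/
  Public : Type u
  [publicSpace : MeasurableSpace Public]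
  /-- The distribution of the public randomness. -/
  publicDist : Measure Public
  [publicDist_prob : IsProbabilityMeasure publicDist]
  /-- The space of reports of each node. -/
  Report : Fin n → Type v
  [reportSpace : ∀ i, MeasurableSpace (Report i)]
  /-- The local randomizers. -/
  randomizer : ∀ i : Fin n, Set (Fin n) → Kernel Public (Report i)
  [randomizer_markov : ∀ i S, IsMarkovKernel (randomizer i S)]
  /-- The postprocessing run by the server. -/
  post : Kernel (∀ i, Report i) ℝ
  [post_markov : IsMarkovKernel post]

namespace LocalAlgorithm

attribute [instance] publicSpace publicDist_prob reportSpace randomizer_markov post_markov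

variable {n : ℕ}

/-- The joint distribution of all reports on input graph `G`, as a function of the public
randomness. Given the public randomness, the nodes use independent local coins. -/
noncomputable def reports (A : LocalAlgorithm n) (G : SimpleGraph (Fin n)) :
    Kernel A.Public (∀ i, A.Report i) where
  toFun ρ := Measure.pi fun i => A.randomizer i (G.neighborSet i) ρ
  measurable' := by
    refine Measurable.measure_of_isPiSystem_of_isProbabilityMeasure generateFrom_pi.symm
      isPiSystem_pi ?_
    rintro _ ⟨s, hs, rfl⟩
    simp only [Measure.pi_pi]
    exact Finset.measurable_prod _ fun i _ =>
      Kernel.measurable_coe _ (hs i (Set.mem_univ i))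

/-- The distribution of the output of the algorithm on input graph `G`. -/
noncomputable def output (A : LocalAlgorithm n) (G : SimpleGraph (Fin n)) : Measure ℝ :=
  (A.publicDist.bind (A.reports G)).bind A.post

/-- `(ε, δ)`-local node differential privacy: for every value of the public randomness, the vector
of reports is `(ε, δ)`-indistinguishable on node-neighboring graphs. -/
def IsLNDP (A : LocalAlgorithm n) (ε δ : ℝ) : Prop :=
  ∀ G G' : SimpleGraph (Fin n), NodeNeighbors G G' →
    ∀ ρ : A.Public, Indistinguishable ε δ (A.reports G ρ) (A.reports G' ρ)

/-- On every `d`-bounded graph, the output is within `α` of the number of edges with probability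
at least `2/3`. -/
def CountsEdges (A : LocalAlgorithm n) (d : ℕ) (α : ℝ) : Prop :=
  ∀ G : SimpleGraph (Fin n), DegreeBounded d G →
    2 / 3 ≤ A.output G {x : ℝ | |x - (G.edgeSet.ncard : ℝ)| ≤ α}

end LocalAlgorithm

/-! Group privacy alone cannot relate the empty graph to a sparse graph `H` with about `d * n / 2`
edges, since nearly all nodes change. Locality helps: for fixed public randomness the reports are
independent, and each depends on one neighborhood only. Join a set `J` of at most `d` nodes to all
other nodes. Only edges at `J` are added, so group privacy bounds the total variation by `3 * d *
ε`, a small constant. Squared Hellinger distance is nearly additive over products, so the per-node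
distances between the reports on `∅` and on `J`, summed over all nodes outside `J`, are small
(`IsLNDP.sum_reportCost_le`). Under a uniformly random relabeling of `H`, each vertex costs on
average at most `2 / n` times this bound; summed over the `n` vertices, the total stays small
(`sum_perm_neighborSet_le`). Hence the output on the empty graph is close, on average, to that on a
relabeled `H`. An accurate algorithm would tell them apart if `H` had more than `2 * α` edges
(`IsLNDP.ncard_edgeSet_le`). A circulant graph supplies an `H` with enough edges. -/

/-! ### Densities and the Bhattacharyya affinity -/

/-- The density of `P` with respect to `P + Q`. -/
noncomputable def leftDensity {Y : Type*} [MeasurableSpace Y] (P Q : Measure Y) (y : Y) : ℝ :=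
  (P.rnDeriv (P + Q) y).toReal

/-- The density of `Q` with respect to `P + Q`. -/
noncomputable def rightDensity {Y : Type*} [MeasurableSpace Y] (P Q : Measure Y) (y : Y) : ℝ :=
  (Q.rnDeriv (P + Q) y).toReal

/-- The Bhattacharyya affinity of two measures. -/
noncomputable def affinity {Y : Type*} [MeasurableSpace Y] (P Q : Measure Y) : ℝ :=
  ∫ y, √(leftDensity P Q y * rightDensity P Q y) ∂(P + Q)

/-- `P` has the measurable, nonnegative, integrable real density `f` with respect to `μ`. -/
structure HasRealDensity {Y : Type*} [MeasurableSpace Y] (P μ : Measure Y) (f : Y → ℝ) :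
    Prop where
  measurable : Measurable f
  nonneg : ∀ y, 0 ≤ f y
  integrable : Integrable f μ
  eq_withDensity : P = μ.withDensity fun y => ENNReal.ofReal (f y)

section Density

variable {Y : Type*} [MeasurableSpace Y] {P Q μ : Measure Y} {f g : Y → ℝ}

theorem hasRealDensity_rnDeriv [IsFiniteMeasure P] [IsFiniteMeasure μ] (h : P ≪ μ) :
    HasRealDensity P μ fun y => (P.rnDeriv μ y).toReal where
  measurable := (Measure.measurable_rnDeriv P μ).ennreal_toReal
  nonneg _ := ENNReal.toReal_nonneg
  integrable := Measure.integrable_toReal_rnDeriv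
  eq_withDensity := by
    conv_lhs => rw [← Measure.withDensity_rnDeriv_eq P μ h]
    refine withDensity_congr_ae ?_
    filter_upwards [Measure.rnDeriv_ne_top P μ] with y hy
    rw [ENNReal.ofReal_toReal hy]

theorem hasRealDensity_leftDensity (P Q : Measure Y) [IsFiniteMeasure P] [IsFiniteMeasure Q] :
    HasRealDensity P (P + Q) (leftDensity P Q) :=
  hasRealDensity_rnDeriv (Measure.AbsolutelyContinuous.rfl.add_right Q)

theorem hasRealDensity_rightDensity (P Q : Measure Y) [IsFiniteMeasure P] [IsFiniteMeasure Q] :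
    HasRealDensity Q (P + Q) (rightDensity P Q) :=
  hasRealDensity_rnDeriv (by
    rw [add_comm]; exact Measure.AbsolutelyContinuous.rfl.add_right P)

theorem HasRealDensity.measureReal_eq (hf : HasRealDensity P μ f) {S : Set Y}
    (hS : MeasurableSet S) : P.real S = ∫ y in S, f y ∂μ := by
  rw [Measure.real, hf.eq_withDensity, withDensity_apply _ hS,
    integral_eq_lintegral_of_nonneg_ae (Filter.Eventually.of_forall hf.nonneg)
      hf.measurable.aestronglyMeasurable]

theorem HasRealDensity.integral_eq_one [IsProbabilityMeasure P] (hf : HasRealDensity P μ f) :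
    ∫ y, f y ∂μ = 1 := by
  have := hf.measureReal_eq MeasurableSet.univ
  simpa using this.symm

theorem HasRealDensity.sqrt_mul_le (hf : HasRealDensity P μ f) (hg : HasRealDensity Q μ g)
    (y : Y) : √(f y * g y) ≤ (f y + g y) / 2 := by
  rw [Real.sqrt_le_left (by linarith [hf.nonneg y, hg.nonneg y])]
  nlinarith [sq_nonneg (f y - g y)]

theorem HasRealDensity.integrable_sqrt_mul (hf : HasRealDensity P μ f)
    (hg : HasRealDensity Q μ g) : Integrable (fun y => √(f y * g y)) μ := by
  refine ((hf.integrable.add hg.integrable).div_const 2).mono'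
    (hf.measurable.mul hg.measurable).sqrt.aestronglyMeasurable
    (Filter.Eventually.of_forall fun y => ?_)
  rw [Real.norm_of_nonneg (Real.sqrt_nonneg _)]
  exact hf.sqrt_mul_le hg y

theorem HasRealDensity.integral_sqrt_mul_le_one [IsProbabilityMeasure P] [IsProbabilityMeasure Q]
    (hf : HasRealDensity P μ f) (hg : HasRealDensity Q μ g) :
    ∫ y, √(f y * g y) ∂μ ≤ 1 := by
  calc ∫ y, √(f y * g y) ∂μ ≤ ∫ y, (f y + g y) / 2 ∂μ :=
        integral_mono (hf.integrable_sqrt_mul hg)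
          ((hf.integrable.add hg.integrable).div_const 2) (hf.sqrt_mul_le hg)
    _ = 1 := by
        rw [integral_div, integral_add hf.integrable hg.integrable, hf.integral_eq_one,
          hg.integral_eq_one]
        norm_num

/-- The affinity is at least one minus the total variation distance. -/
theorem HasRealDensity.one_sub_le_integral_sqrt_mul [IsProbabilityMeasure P]
    (hf : HasRealDensity P μ f)
    (hg : HasRealDensity Q μ g) {c : ℝ}
    (h : ∀ S, MeasurableSet S → P.real S ≤ Q.real S + c) :
    1 - c ≤ ∫ y, √(f y * g y) ∂μ := by
  have hS : MeasurableSet {y | g y ≤ f y} := measurableSet_le hg.measurable hf.measurable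
  have hd : Integrable (fun y => f y - g y) μ := hf.integrable.sub hg.integrable
  have h1 := h _ hS
  rw [hf.measureReal_eq hS, hg.measureReal_eq hS] at h1
  have h2 : ∫ y in {y | g y ≤ f y}, (f y - g y) ∂μ ≤ c := by
    rw [integral_sub hf.integrable.integrableOn hg.integrable.integrableOn]
    linarith
  rw [← integral_indicator hS] at h2
  -- The integrand on the left is `min (f y) (g y)`, which is at most the geometric mean.
  have h3 : ∫ y, (f y - Set.indicator {y | g y ≤ f y} (fun y => f y - g y) y) ∂μ
      ≤ ∫ y, √(f y * g y) ∂μ := by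
    refine integral_mono (hf.integrable.sub (hd.indicator hS)) (hf.integrable_sqrt_mul hg)
      fun y => ?_
    have hf0 := hf.nonneg y
    have hg0 := hg.nonneg y
    refine Real.le_sqrt_of_sq_le ?_
    by_cases hy : g y ≤ f y
    · rw [Set.indicator_of_mem (by exact hy)]
      nlinarith
    · rw [Set.indicator_of_notMem (by exact hy)]
      push Not at hy
      nlinarith
  rw [integral_sub hf.integrable (hd.indicator hS), hf.integral_eq_one] at h3
  linarith

/-- Two distributions with affinity close to one assign close expectations to bounded tests. -/
theorem HasRealDensity.lintegral_le [IsProbabilityMeasure P] [IsProbabilityMeasure Q]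
    (hf : HasRealDensity P μ f) (hg : HasRealDensity Q μ g) {t : ℝ} (ht : 0 < t)
    {φ : Y → ℝ≥0∞} (hφ : Measurable φ) (hφ1 : ∀ y, φ y ≤ 1) :
    ∫⁻ y, φ y ∂P ≤ ∫⁻ y, φ y ∂Q +
      ENNReal.ofReal ((1 - ∫ y, √(f y * g y) ∂μ) / t + 2 * t) := by
  have hfm := hf.measurable.ennreal_ofReal
  have hgm := hg.measurable.ennreal_ofReal
  have hd : Integrable (fun y => |f y - g y|) μ := (hf.integrable.sub hg.integrable).abs
  -- AM-GM with weight `t` on `|√f - √g| * (√f + √g)`, then `(√f + √g)² ≤ 2 * (f + g)`. Keeping `t`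
  -- free makes the bound affine in the affinity, so it can be averaged directly.
  have hpt : ∀ y, |f y - g y| ≤
      ((f y + g y) - 2 * √(f y * g y)) / (2 * t) + (f y + g y) * t := by
    intro y
    obtain ⟨a, ha, hfa⟩ : ∃ a, 0 ≤ a ∧ f y = a ^ 2 :=
      ⟨√(f y), Real.sqrt_nonneg _, (Real.sq_sqrt (hf.nonneg y)).symm⟩
    obtain ⟨b, hb, hgb⟩ : ∃ b, 0 ≤ b ∧ g y = b ^ 2 :=
      ⟨√(g y), Real.sqrt_nonneg _, (Real.sq_sqrt (hg.nonneg y)).symm⟩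
    rw [hfa, hgb, ← mul_pow, Real.sqrt_sq (mul_nonneg ha hb)]
    have e : (a ^ 2 + b ^ 2 - 2 * (a * b)) / (2 * t) = (a - b) ^ 2 / (2 * t) := by ring
    rw [e, ← sub_le_iff_le_add, le_div_iff₀ (by positivity)]
    have e2 : |a ^ 2 - b ^ 2| = |a - b| * (a + b) := by
      rw [show a ^ 2 - b ^ 2 = (a - b) * (a + b) by ring, abs_mul,
        abs_of_nonneg (add_nonneg ha hb)]
    rw [e2, ← sq_abs (a - b)]
    nlinarith [sq_nonneg (|a - b| - t * (a + b)), mul_nonneg ha hb, sq_nonneg (a - b),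
      mul_nonneg (sq_nonneg t) (sq_nonneg (a - b))]
  have hI1 : Integrable (fun y => ((f y + g y) - 2 * √(f y * g y)) / (2 * t)) μ :=
    ((hf.integrable.add hg.integrable).sub
      ((hf.integrable_sqrt_mul hg).const_mul 2)).div_const _
  have hI2 : Integrable (fun y => (f y + g y) * t) μ :=
    (hf.integrable.add hg.integrable).mul_const t
  have hint : ∫ y, |f y - g y| ∂μ ≤ (1 - ∫ y, √(f y * g y) ∂μ) / t + 2 * t := by
    calc ∫ y, |f y - g y| ∂μ
        ≤ ∫ y, (((f y + g y) - 2 * √(f y * g y)) / (2 * t) + (f y + g y) * t) ∂μ :=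
          integral_mono hd (hI1.add hI2) hpt
      _ = (1 - ∫ y, √(f y * g y) ∂μ) / t + 2 * t := by
          rw [integral_add hI1 hI2, integral_div, integral_mul_const,
            integral_sub (f := fun y => f y + g y) (hf.integrable.add hg.integrable)
              ((hf.integrable_sqrt_mul hg).const_mul 2),
            integral_const_mul, integral_add hf.integrable hg.integrable, hf.integral_eq_one,
            hg.integral_eq_one]
          field_simp
          ring
  have hP : ∫⁻ y, φ y ∂P = ∫⁻ y, ENNReal.ofReal (f y) * φ y ∂μ := by
    conv_lhs => rw [hf.eq_withDensity, lintegral_withDensity_eq_lintegral_mul _ hfm hφ]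
    rfl
  have hQ : ∫⁻ y, φ y ∂Q = ∫⁻ y, ENNReal.ofReal (g y) * φ y ∂μ := by
    conv_lhs => rw [hg.eq_withDensity, lintegral_withDensity_eq_lintegral_mul _ hgm hφ]
    rfl
  calc ∫⁻ y, φ y ∂P
      ≤ ∫⁻ y, (ENNReal.ofReal (g y) * φ y + ENNReal.ofReal |f y - g y|) ∂μ := by
        rw [hP]
        refine lintegral_mono fun y => ?_
        calc ENNReal.ofReal (f y) * φ y
            ≤ (ENNReal.ofReal (g y) + ENNReal.ofReal |f y - g y|) * φ y := by
              rw [← ENNReal.ofReal_add (hg.nonneg y) (abs_nonneg _)]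
              gcongr
              linarith [le_abs_self (f y - g y)]
          _ ≤ ENNReal.ofReal (g y) * φ y + ENNReal.ofReal |f y - g y| := by
              rw [add_mul]
              gcongr
              exact mul_le_of_le_one_right' (hφ1 y)
    _ = ∫⁻ y, φ y ∂Q + ENNReal.ofReal (∫ y, |f y - g y| ∂μ) := by
        rw [lintegral_add_left (by fun_prop), hQ, ofReal_integral_eq_lintegral_ofReal hd
          (Filter.Eventually.of_forall fun y => abs_nonneg _)]
    _ ≤ _ := by gcongr

theorem affinity_le_one (P Q : Measure Y) [IsProbabilityMeasure P] [IsProbabilityMeasure Q] :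
    affinity P Q ≤ 1 :=
  (hasRealDensity_leftDensity P Q).integral_sqrt_mul_le_one (hasRealDensity_rightDensity P Q)

theorem affinity_nonneg (P Q : Measure Y) : 0 ≤ affinity P Q :=
  integral_nonneg fun _ => Real.sqrt_nonneg _

end Density

/-! ### Affinity of product measures -/

section Pi

variable {ι : Type*} [Fintype ι] {Y : ι → Type*} [∀ i, MeasurableSpace (Y i)]

/-- This is why the dominating measure is arbitrary in `HasRealDensity`: two products are compared
over the product of the `P i + Q i`, not over the sum of the products. -/
theorem HasRealDensity.pi {P μ : ∀ i, Measure (Y i)} [∀ i, IsFiniteMeasure (P i)]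
    [∀ i, IsFiniteMeasure (μ i)] {f : ∀ i, Y i → ℝ}
    (hf : ∀ i, HasRealDensity (P i) (μ i) (f i)) :
    HasRealDensity (Measure.pi P) (Measure.pi μ) fun y => ∏ i, f i (y i) where
  measurable := Finset.measurable_prod _ fun i _ =>
    (hf i).measurable.comp (measurable_pi_apply i)
  nonneg y := Finset.prod_nonneg fun i _ => (hf i).nonneg _
  integrable := Integrable.fintype_prod_dep fun i => (hf i).integrable
  eq_withDensity := by
    refine Measure.pi_eq fun S hS => ?_
    have hrect : MeasurableSet (Set.univ.pi S) := MeasurableSet.univ_pi hS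
    have hint : Integrable (fun y : ∀ i, Y i => ∏ i, (S i).indicator (f i) (y i))
        (Measure.pi μ) :=
      Integrable.fintype_prod_dep fun i => (hf i).integrable.indicator (hS i)
    rw [withDensity_apply _ hrect, ← lintegral_indicator hrect]
    have hind : ∀ y, (Set.univ.pi S).indicator
        (fun y => ENNReal.ofReal (∏ i, f i (y i))) y =
        ENNReal.ofReal (∏ i, (S i).indicator (f i) (y i)) := by
      intro y
      by_cases hy : y ∈ Set.univ.pi S
      · rw [Set.indicator_of_mem hy]
        congr 1
        refine Finset.prod_congr rfl fun i _ => ?_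
        rw [Set.indicator_of_mem (hy i (Set.mem_univ i))]
      · rw [Set.indicator_of_notMem hy]
        simp only [Set.mem_univ_pi, not_forall] at hy
        obtain ⟨i, hi⟩ := hy
        rw [Finset.prod_eq_zero (Finset.mem_univ i) (Set.indicator_of_notMem hi _),
          ENNReal.ofReal_zero]
    rw [lintegral_congr hind, ← ofReal_integral_eq_lintegral_ofReal hint
        (Filter.Eventually.of_forall fun y => Finset.prod_nonneg fun i _ =>
          Set.indicator_nonneg (fun _ _ => (hf i).nonneg _) _),
      integral_fintype_prod_eq_prod, ENNReal.ofReal_prod_of_nonneg fun i _ =>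
        integral_nonneg fun _ => Set.indicator_nonneg (fun _ _ => (hf i).nonneg _) _]
    refine Finset.prod_congr rfl fun i _ => ?_
    rw [integral_indicator (hS i), ← (hf i).measureReal_eq (hS i), ofReal_measureReal]

variable (P Q : ∀ i, Measure (Y i)) [∀ i, IsProbabilityMeasure (P i)]
  [∀ i, IsProbabilityMeasure (Q i)]

theorem integral_sqrt_mul_pi :
    ∫ y, √((∏ i, leftDensity (P i) (Q i) (y i)) * ∏ i, rightDensity (P i) (Q i) (y i))
      ∂(Measure.pi fun i => P i + Q i) = ∏ i, affinity (P i) (Q i) := by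
  simp only [affinity]
  rw [← integral_fintype_prod_eq_prod]
  refine integral_congr_ae (Filter.Eventually.of_forall fun y => ?_)
  simp only
  rw [← Finset.prod_mul_distrib, Real.sqrt_prod]
  exact fun i _ => mul_nonneg ENNReal.toReal_nonneg ENNReal.toReal_nonneg

theorem one_sub_le_prod_affinity {c : ℝ}
    (h : ∀ S, MeasurableSet S → (Measure.pi P).real S ≤ (Measure.pi Q).real S + c) :
    1 - c ≤ ∏ i, affinity (P i) (Q i) := by
  rw [← integral_sqrt_mul_pi]
  exact (HasRealDensity.pi fun i =>
    hasRealDensity_leftDensity (P i) (Q i)).one_sub_le_integral_sqrt_mul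
    (HasRealDensity.pi fun i => hasRealDensity_rightDensity (P i) (Q i)) h

theorem lintegral_pi_le {t : ℝ} (ht : 0 < t) {φ : (∀ i, Y i) → ℝ≥0∞} (hφ : Measurable φ)
    (hφ1 : ∀ y, φ y ≤ 1) :
    ∫⁻ y, φ y ∂(Measure.pi P) ≤ ∫⁻ y, φ y ∂(Measure.pi Q) +
      ENNReal.ofReal ((1 - ∏ i, affinity (P i) (Q i)) / t + 2 * t) := by
  rw [← integral_sqrt_mul_pi]
  exact (HasRealDensity.pi fun i => hasRealDensity_leftDensity (P i) (Q i)).lintegral_le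
    (HasRealDensity.pi fun i => hasRealDensity_rightDensity (P i) (Q i)) ht hφ hφ1

/-- If two product distributions are close in total variation, then the sum of the squared
Hellinger distances of their factors is small. -/
theorem sum_one_sub_affinity_le {c : ℝ} (hc : c < 1)
    (h : ∀ S, MeasurableSet S → (Measure.pi P).real S ≤ (Measure.pi Q).real S + c) :
    ∑ i, (1 - affinity (P i) (Q i)) ≤ (1 - c)⁻¹ - 1 := by
  have h1 := one_sub_le_prod_affinity P Q h
  -- Each factor satisfies `a ≤ exp (-(1 - a))`, so a product bounded below forces a small sum of
  -- defects.
  have h2 : ∏ i, affinity (P i) (Q i) ≤ Real.exp (-∑ i, (1 - affinity (P i) (Q i))) := by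
    rw [← Finset.sum_neg_distrib, Real.exp_sum]
    refine Finset.prod_le_prod (fun i _ => affinity_nonneg _ _) fun i _ => ?_
    have := Real.add_one_le_exp (-(1 - affinity (P i) (Q i)))
    linarith
  have h3 : Real.exp (∑ i, (1 - affinity (P i) (Q i))) ≤ (1 - c)⁻¹ := by
    rw [← neg_neg (∑ i, (1 - affinity (P i) (Q i))), Real.exp_neg]
    exact inv_anti₀ (by linarith) (h1.trans h2)
  linarith [Real.add_one_le_exp (∑ i, (1 - affinity (P i) (Q i)))]

theorem one_sub_prod_affinity_le :
    1 - ∏ i, affinity (P i) (Q i) ≤ ∑ i, (1 - affinity (P i) (Q i)) := by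
  classical
  have key : ∀ s : Finset ι, 0 ≤ ∏ i ∈ s, affinity (P i) (Q i) ∧
      ∏ i ∈ s, affinity (P i) (Q i) ≤ 1 ∧
      1 - ∏ i ∈ s, affinity (P i) (Q i) ≤ ∑ i ∈ s, (1 - affinity (P i) (Q i)) := by
    intro s
    induction s using Finset.induction_on with
    | empty => simp
    | insert j s hj ih =>
      obtain ⟨h0, h1, h2⟩ := ih
      rw [Finset.prod_insert hj, Finset.sum_insert hj]
      have a0 := affinity_nonneg (P j) (Q j)
      have a1 := affinity_le_one (P j) (Q j)
      exact ⟨mul_nonneg a0 h0, mul_le_one₀ a1 h0 h1, by nlinarith⟩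
  exact (key Finset.univ).2.2

end Pi

/-! ### Averaging over relabelings -/

section Combinatorics

variable {n : ℕ}

/-- The sum over all relabelings of the value of `h` at the relabeled pair `(v, N)`. -/
noncomputable def permSum (h : Fin n → Set (Fin n) → ℝ) (v : Fin n) (N : Set (Fin n)) : ℝ :=
  ∑ σ : Equiv.Perm (Fin n), h (σ.symm v) (σ ⁻¹' N)

/-- Composing with the transposition of `v` and `w` permutes the relabelings and leaves the preimage
of `N` unchanged, as `N` contains neither point. -/
theorem permSum_congr (h : Fin n → Set (Fin n) → ℝ) {N : Set (Fin n)} {v w : Fin n}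
    (hv : v ∉ N) (hw : w ∉ N) : permSum h v N = permSum h w N := by
  unfold permSum
  rw [← Equiv.sum_comp (Equiv.mulLeft (Equiv.swap v w))]
  refine Finset.sum_congr rfl fun σ _ => ?_
  congr 1
  · simp [Equiv.Perm.mul_def]
  · ext x
    simp only [Equiv.coe_mulLeft, Equiv.Perm.coe_mul, Set.mem_preimage, Function.comp_apply]
    by_cases h1 : σ x = v
    · simp [h1, hv, hw]
    by_cases h2 : σ x = w
    · simp [h2, hv, hw]
    rw [Equiv.swap_apply_of_ne_of_ne h1 h2]

theorem permSum_nonneg {h : Fin n → Set (Fin n) → ℝ} (h0 : ∀ i S, 0 ≤ h i S) (v : Fin n)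
    (N : Set (Fin n)) : 0 ≤ permSum h v N :=
  Finset.sum_nonneg fun _ _ => h0 _ _

/-- By symmetry `permSum h v N` equals its average over all vertices outside `N`. For each
relabeling, the sum over these vertices is a sum over the complement of one set `J` of size
`N.card`, hence at most `B`. The factor 2 comes from `n - N.card ≥ n / 2`. -/
theorem mul_permSum_le {h : Fin n → Set (Fin n) → ℝ} (h0 : ∀ i S, 0 ≤ h i S) {d : ℕ}
    (hd : 2 * d ≤ n) {B : ℝ}
    (hsum : ∀ J : Finset (Fin n), J.card ≤ d → ∑ i ∈ Jᶜ, h i J ≤ B)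
    {v : Fin n} {N : Finset (Fin n)} (hN : N.card ≤ d) (hv : v ∉ N) :
    n * permSum h v N ≤ n.factorial * (2 * B) := by
  have h1 : ((n - N.card : ℕ) : ℝ) * permSum h v N = ∑ w ∈ Nᶜ, permSum h w N := by
    rw [Finset.sum_congr rfl fun w hw => permSum_congr h (w := v)
      (by simpa using hw) (by simpa using hv)]
    rw [Finset.sum_const, Finset.card_compl, Fintype.card_fin, nsmul_eq_mul]
  have h2 : ∑ w ∈ Nᶜ, permSum h w N ≤ n.factorial * B := by
    unfold permSum
    rw [Finset.sum_comm]
    calc ∑ σ : Equiv.Perm (Fin n), ∑ w ∈ Nᶜ, h (σ.symm w) (σ ⁻¹' (N : Set (Fin n)))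
        ≤ ∑ σ : Equiv.Perm (Fin n), B := by
          refine Finset.sum_le_sum fun σ _ => ?_
          have e : σ ⁻¹' (N : Set (Fin n)) = (N.map σ.symm.toEmbedding : Finset (Fin n)) := by
            ext x; simp
          refine le_of_eq_of_le ?_
            (hsum (N.map σ.symm.toEmbedding) (by rwa [Finset.card_map]))
          rw [e]
          refine Finset.sum_bij (fun w _ => σ.symm w) ?_ ?_ ?_ ?_
          · intro w hw
            simpa using hw
          · intro a _ b _ hab
            simpa using hab
          · intro b hb
            exact ⟨σ b, by simpa using hb, by simp⟩
          · intro a _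
            rfl
      _ = n.factorial * B := by
          rw [Finset.sum_const, Finset.card_univ, Fintype.card_perm, Fintype.card_fin,
            nsmul_eq_mul]
  have h3 : (n : ℝ) ≤ 2 * ((n - N.card : ℕ) : ℝ) := by
    have : n ≤ 2 * (n - N.card) := by omega
    exact_mod_cast this
  have h4 := permSum_nonneg h0 v N
  nlinarith

/-- If the `h`-cost of the complete bipartite neighborhoods of every small node set is at most
`B`, then the average `h`-cost of the relabelings of a graph of bounded degree is at most
`2 * B`. -/
theorem sum_perm_neighborSet_le {h : Fin n → Set (Fin n) → ℝ} (h0 : ∀ i S, 0 ≤ h i S) {d : ℕ}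
    (hn : 0 < n) (hd : 2 * d ≤ n) {B : ℝ}
    (hsum : ∀ J : Finset (Fin n), J.card ≤ d → ∑ i ∈ Jᶜ, h i J ≤ B)
    {H : SimpleGraph (Fin n)} (hH : DegreeBounded d H) :
    ∑ σ : Equiv.Perm (Fin n), ∑ i, h i ((H.comap σ).neighborSet i) ≤
      n.factorial * (2 * B) := by
  classical
  have h1 : ∑ σ : Equiv.Perm (Fin n), ∑ i, h i ((H.comap σ).neighborSet i) =
      ∑ v, permSum h v (H.neighborSet v) := by
    unfold permSum
    rw [Finset.sum_comm (s := (Finset.univ : Finset (Fin n)))]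
    refine Finset.sum_congr rfl fun σ _ => ?_
    rw [← Equiv.sum_comp σ.symm]
    refine Finset.sum_congr rfl fun v _ => ?_
    congr 1
    ext x
    simp
  rw [h1]
  have hn' : (0 : ℝ) < n := by exact_mod_cast hn
  have h2 : ∀ v, permSum h v (H.neighborSet v) ≤ n.factorial * (2 * B) / n := by
    intro v
    have hc := hH v
    rw [Set.ncard_eq_toFinset_card'] at hc
    have := mul_permSum_le h0 hd hsum (v := v) hc (by simp)
    rw [Set.coe_toFinset] at this
    rw [le_div_iff₀ hn']
    linarith
  calc ∑ v, permSum h v (H.neighborSet v)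
      ≤ ∑ v : Fin n, (n.factorial * (2 * B) / n : ℝ) := Finset.sum_le_sum fun v _ => h2 v
    _ = n.factorial * (2 * B) := by
        rw [Finset.sum_const, Finset.card_univ, Fintype.card_fin, nsmul_eq_mul]
        field_simp

/-! ### Near-regular graphs with many edges -/

/-- A circulant graph of degree `d`, with every second edge of a longest cycle when `d` is odd. -/
def nearRegularGraph (n d : ℕ) : SimpleGraph (Fin n) where
  Adj u v := u ≠ v ∧ ((u : ℕ) - v + (v - u) ≤ d / 2 ∨ n - d / 2 ≤ (u : ℕ) - v + (v - u) ∨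
    (d % 2 = 1 ∧ (u : ℕ) - v + (v - u) = (n + 1) / 2))
  symm := ⟨fun u v h => ⟨h.1.symm, by have := h.2; omega⟩⟩
  loopless := ⟨fun _ h => h.1 rfl⟩

theorem degreeBounded_nearRegularGraph {d : ℕ} (hd : d < n) :
    DegreeBounded d (nearRegularGraph n d) := by
  intro u
  -- With truncated subtraction, the sum in the adjacency is `|u - v|`. Here `f v` is the residue of
  -- `v - u` modulo `n`, taken in `1, ..., n`, and `T` contains the residues of all neighbors. For
  -- odd `d` there is at most one extra neighbor, whose side depends on the half containing `u`.
  let f : Fin n → ℕ := fun v => if (u : ℕ) < v then (v : ℕ) - u else v + n - u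
  let T : Finset ℕ := (Finset.Icc 1 (d / 2) ∪ Finset.Icc (n - d / 2) (n - 1)) ∪
    (if d % 2 = 1 then {if (u : ℕ) < n / 2 then (n + 1) / 2 else n / 2} else ∅)
  have hT : T.card ≤ d := by
    have h1 := Finset.card_union_le (Finset.Icc 1 (d / 2) ∪ Finset.Icc (n - d / 2) (n - 1))
      (if d % 2 = 1 then {if (u : ℕ) < n / 2 then (n + 1) / 2 else n / 2} else ∅)
    have h2 := Finset.card_union_le (Finset.Icc 1 (d / 2)) (Finset.Icc (n - d / 2) (n - 1))
    have h3 : (if d % 2 = 1 then {if (u : ℕ) < n / 2 then (n + 1) / 2 else n / 2} else ∅ :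
        Finset ℕ).card ≤ d % 2 := by
      split_ifs <;> simp [*]
    simp only [Nat.card_Icc] at h2
    change (_ ∪ _ : Finset ℕ).card ≤ d
    omega
  refine le_trans ?_ hT
  rw [← Set.ncard_coe_finset T]
  refine Set.ncard_le_ncard_of_injOn f ?_ ?_ T.finite_toSet
  · intro v hv
    obtain ⟨hne, hv⟩ := hv
    have hne' : (u : ℕ) ≠ v := fun h => hne (Fin.ext h)
    have hu := u.isLt
    have hvn := v.isLt
    simp only [Finset.mem_coe, T, Finset.mem_union, Finset.mem_Icc, f]
    by_cases ho : d % 2 = 1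
    · rw [if_pos ho, Finset.mem_singleton]
      split_ifs <;> omega
    · rw [if_neg ho]
      left
      split_ifs <;> omega
  · intro v hv w hw hvw
    have hne1 : (u : ℕ) ≠ v := fun h => hv.1 (Fin.ext h)
    have hne2 : (u : ℕ) ≠ w := fun h => hw.1 (Fin.ext h)
    have hvn := v.isLt
    have hwn := w.isLt
    simp only [f] at hvw
    ext
    split_ifs at hvw <;> omega

theorem le_ncard_edgeSet_nearRegularGraph {d : ℕ} (hd : d < n) :
    d * n / 2 ≤ (nearRegularGraph n d).edgeSet.ncard := by
  -- Edges as increasing pairs: `n` for each of the `d / 2` cyclic shifts and, for odd `d`, a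
  -- matching of `n / 2` pairs at distance `(n + 1) / 2`. Since `d < n`, there are no repetitions.
  let p : (Fin (d / 2) × Fin n) ⊕ Fin (d % 2 * (n / 2)) → ℕ × ℕ := Sum.elim
    (fun x => if (x.2 : ℕ) + x.1 + 1 < n then ((x.2 : ℕ), (x.2 : ℕ) + x.1 + 1)
      else ((x.2 : ℕ) + x.1 + 1 - n, (x.2 : ℕ)))
    (fun a => ((a : ℕ), (a : ℕ) + (n + 1) / 2))
  have hodd : ∀ a : Fin (d % 2 * (n / 2)), d % 2 = 1 ∧ (a : ℕ) < n / 2 := by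
    intro a
    have ha := a.isLt
    rcases Nat.mod_two_eq_zero_or_one d with h | h
    · simp [h] at ha
    · exact ⟨h, by simpa [h] using ha⟩
  have hp : ∀ x, (p x).1 < (p x).2 ∧ (p x).2 < n := by
    rintro (⟨s, a⟩ | a)
    · have hs := s.isLt
      have ha := a.isLt
      simp only [p, Sum.elim_inl]
      split_ifs <;> constructor <;> simp only <;> omega
    · have ha := hodd a
      simp only [p, Sum.elim_inr]
      omega
  have hpinj : Function.Injective p := by
    rintro (⟨s, a⟩ | a) (⟨t, b⟩ | b) hab
    · have hs := s.isLt
      have ht := t.isLt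
      have ha := a.isLt
      have hb := b.isLt
      simp only [p, Sum.elim_inl] at hab
      rw [Sum.inl.injEq, Prod.mk.injEq, Fin.ext_iff, Fin.ext_iff]
      split_ifs at hab <;> rw [Prod.mk.injEq] at hab <;> omega
    · have hs := s.isLt
      have ha := a.isLt
      have hb := hodd b
      simp only [p, Sum.elim_inl, Sum.elim_inr] at hab
      split_ifs at hab <;> rw [Prod.mk.injEq] at hab <;> omega
    · have hs := t.isLt
      have ha := b.isLt
      have hb := hodd a
      simp only [p, Sum.elim_inl, Sum.elim_inr] at hab
      split_ifs at hab <;> rw [Prod.mk.injEq] at hab <;> omega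
    · simp only [p, Sum.elim_inr, Prod.mk.injEq] at hab
      rw [Sum.inr.injEq, Fin.ext_iff]
      exact hab.1
  have hadj : ∀ x, (nearRegularGraph n d).Adj ⟨(p x).1, (hp x).1.trans (hp x).2⟩
      ⟨(p x).2, (hp x).2⟩ := by
    intro x
    refine ⟨fun h => (hp x).1.ne (Fin.ext_iff.1 h), ?_⟩
    simp only
    rcases x with ⟨s, a⟩ | a
    · have hs := s.isLt
      have ha := a.isLt
      simp only [p, Sum.elim_inl]
      split_ifs <;> simp only <;> omega
    · have ha := hodd a
      simp only [p, Sum.elim_inr]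
      omega
  let e : (Fin (d / 2) × Fin n) ⊕ Fin (d % 2 * (n / 2)) → (nearRegularGraph n d).edgeSet :=
    fun x => ⟨s(⟨(p x).1, (hp x).1.trans (hp x).2⟩, ⟨(p x).2, (hp x).2⟩), hadj x⟩
  have he : Function.Injective e := by
    intro x y hxy
    have h := congrArg Subtype.val hxy
    simp only [e, Sym2.eq_iff, Fin.mk.injEq] at h
    have hx := hp x
    have hy := hp y
    apply hpinj
    ext <;> omega
  have hcard := Nat.card_le_card_of_injective e he
  rw [Nat.card_eq_fintype_card, Fintype.card_sum, Fintype.card_prod, Fintype.card_fin,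
    Fintype.card_fin, Fintype.card_fin, Nat.card_coe_set_eq] at hcard
  refine le_trans ?_ hcard
  have hdm := Nat.div_add_mod d 2
  have hdn : d * n = 2 * (d / 2 * n) + d % 2 * n := by
    nth_rewrite 1 [← hdm]
    ring
  rcases Nat.mod_two_eq_zero_or_one d with h | h <;> rw [h] at hdn ⊢ <;> omega

end Combinatorics

/-! ### From privacy to Hellinger bounds -/

theorem Indistinguishable.measureReal_le {Y : Type*} [MeasurableSpace Y] {ε δ : ℝ}
    {μ ν : Measure Y} [IsProbabilityMeasure μ] [IsProbabilityMeasure ν]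
    (h : Indistinguishable ε δ μ ν) (hε : 0 ≤ ε) (hε1 : ε ≤ 1) (hδ : 0 ≤ δ) (hδε : δ ≤ ε)
    {S : Set Y} (hS : MeasurableSet S) : μ.real S ≤ ν.real S + 3 * ε := by
  have h1 := ENNReal.toReal_mono (by finiteness) (h S hS).1
  rw [ENNReal.toReal_add (by finiteness) (by finiteness), ENNReal.toReal_mul,
    ENNReal.toReal_ofReal (Real.exp_pos _).le, ENNReal.toReal_ofReal hδ] at h1
  change μ.real S ≤ Real.exp ε * ν.real S + δ at h1
  have h2 : Real.exp ε ≤ 1 + 2 * ε := by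
    have := Real.abs_exp_sub_one_le (x := ε) (by rwa [abs_of_nonneg hε])
    rw [abs_of_nonneg hε] at this
    linarith [le_abs_self (Real.exp ε - 1)]
  have h3 : ν.real S ≤ 1 := measureReal_le_one
  have h4 : 0 ≤ ν.real S := measureReal_nonneg
  nlinarith

/-- The complete bipartite graph between `J` and its complement. -/
def splitGraph {n : ℕ} (J : Finset (Fin n)) : SimpleGraph (Fin n) where
  Adj u v := (u ∈ J ∧ v ∉ J) ∨ (v ∈ J ∧ u ∉ J)
  symm := ⟨fun _ _ h => h.symm⟩
  loopless := ⟨fun _ h => by tauto⟩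

theorem neighborSet_splitGraph {n : ℕ} {J : Finset (Fin n)} {i : Fin n} (hi : i ∉ J) :
    (splitGraph J).neighborSet i = J := by
  ext v
  simp [splitGraph, hi]

namespace LocalAlgorithm

variable {n : ℕ} {A : LocalAlgorithm.{u, v} n} {ε δ : ℝ}

instance (G : SimpleGraph (Fin n)) (ρ : A.Public) : IsProbabilityMeasure (A.reports G ρ) :=
  inferInstanceAs (IsProbabilityMeasure (Measure.pi _))

/-- Group privacy: graphs that differ only at edges incident to a node of `J`. -/
theorem IsLNDP.measureReal_reports_le (hA : A.IsLNDP ε δ) (hε : 0 ≤ ε) (hε1 : ε ≤ 1)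
    (hδ : 0 ≤ δ) (hδε : δ ≤ ε) (ρ : A.Public) (J : Finset (Fin n)) :
    ∀ G G' : SimpleGraph (Fin n), (∀ u v, u ∉ J → v ∉ J → (G.Adj u v ↔ G'.Adj u v)) →
      ∀ S, MeasurableSet S →
        (A.reports G ρ).real S ≤ (A.reports G' ρ).real S + J.card * (3 * ε) := by
  induction J using Finset.induction_on with
  | empty =>
    intro G G' h S _
    have : G = G' := by
      ext u v
      exact h u v (by simp) (by simp)
    simp [this]
  | insert j J hj ih =>
    intro G G' h S hS
    -- The hybrid takes its edges at `j` from `G'` and all others from `G`. Working in total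
    -- variation makes the losses add instead of compounding.
    let K : SimpleGraph (Fin n) :=
      { Adj := fun u v => if u = j ∨ v = j then G'.Adj u v else G.Adj u v
        symm := ⟨fun u v huv => by
          simpa only [or_comm, G.adj_comm, G'.adj_comm] using huv⟩
        loopless := ⟨fun u hu => by
          split_ifs at hu
          · exact G'.loopless.irrefl u hu
          · exact G.loopless.irrefl u hu⟩ }
    have h1 : NodeNeighbors G K := ⟨j, fun u v hu hv => by simp [K, hu, hv]⟩
    have h2 : ∀ u v, u ∉ J → v ∉ J → (K.Adj u v ↔ G'.Adj u v) := by
      intro u v hu hv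
      by_cases hj' : u = j ∨ v = j
      · simp [K, hj']
      · have := h u v (by simp; tauto) (by simp; tauto)
        simp [K, hj', this]
    have h3 := (hA G K h1 ρ).measureReal_le hε hε1 hδ hδε hS
    have h4 := ih K G' h2 S hS
    rw [Finset.card_insert_of_notMem hj]
    push_cast
    linarith

/-- The squared Hellinger distance between the reports of node `i` on an empty neighborhood and
on the neighborhood `N`. -/
noncomputable def reportCost (A : LocalAlgorithm.{u, v} n) (ρ : A.Public) (i : Fin n)
    (N : Set (Fin n)) : ℝ :=
  1 - affinity (A.randomizer i ∅ ρ) (A.randomizer i N ρ)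

theorem reportCost_nonneg (ρ : A.Public) (i : Fin n) (N : Set (Fin n)) :
    0 ≤ A.reportCost ρ i N :=
  sub_nonneg.2 (affinity_le_one _ _)

theorem reports_bot (ρ : A.Public) :
    A.reports ⊥ ρ = Measure.pi fun i => A.randomizer i ∅ ρ := by
  change (Measure.pi fun i => A.randomizer i _ ρ) = _
  simp only [SimpleGraph.neighborSet_bot]

/-- In `splitGraph J` every node outside `J` has the same neighborhood `J`, so one application of
group privacy, at cost `3 * d * ε ≤ 3 / 1000`, controls all these nodes at once. The sum is then at
most `3 / 997`. -/
theorem IsLNDP.sum_reportCost_le (hA : A.IsLNDP ε δ) (hε : 0 ≤ ε) (hε1 : ε ≤ 1)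
    (hδ : 0 ≤ δ) (hδε : δ ≤ ε) (ρ : A.Public) {d : ℕ} (hd : d * ε ≤ 1 / 1000)
    (J : Finset (Fin n)) (hJ : J.card ≤ d) :
    ∑ i ∈ Jᶜ, A.reportCost ρ i J ≤ 1 / 300 := by
  have hJd : (J.card : ℝ) ≤ d := by exact_mod_cast hJ
  have h1 : ∀ S, MeasurableSet S → (Measure.pi fun i => A.randomizer i ∅ ρ).real S ≤
      (Measure.pi fun i => A.randomizer i ((splitGraph J).neighborSet i) ρ).real S
        + 3 / 1000 := by
    intro S hS
    have := hA.measureReal_reports_le hε hε1 hδ hδε ρ J ⊥ (splitGraph J)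
      (fun u v hu hv => by simp [splitGraph, hu, hv]) S hS
    rw [reports_bot] at this
    change _ ≤ (Measure.pi fun i => A.randomizer i ((splitGraph J).neighborSet i) ρ).real S
      + _ at this
    nlinarith
  have h2 := sum_one_sub_affinity_le _ _ (by norm_num) h1
  calc ∑ i ∈ Jᶜ, A.reportCost ρ i J
      = ∑ i ∈ Jᶜ, A.reportCost ρ i ((splitGraph J).neighborSet i) :=
        Finset.sum_congr rfl fun i hi => by
          rw [neighborSet_splitGraph (Finset.mem_compl.1 hi)]
    _ ≤ ∑ i, A.reportCost ρ i ((splitGraph J).neighborSet i) :=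
        Finset.sum_le_sum_of_subset_of_nonneg (Finset.subset_univ _)
          fun i _ _ => reportCost_nonneg _ _ _
    _ ≤ 1 / 300 := by
        refine le_trans h2 ?_
        norm_num

/-- The reports on the empty graph are close, on average, to the reports on the relabelings of a
fixed graph of bounded degree. -/
theorem IsLNDP.sum_perm_lintegral_le (hA : A.IsLNDP ε δ) (hε : 0 ≤ ε) (hε1 : ε ≤ 1)
    (hδ : 0 ≤ δ) (hδε : δ ≤ ε) (ρ : A.Public) {d : ℕ} (hn : 0 < n)
    (hd : d * ε ≤ 1 / 1000) {H : SimpleGraph (Fin n)} (hH : DegreeBounded d H)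
    {φ : (∀ i, A.Report i) → ℝ≥0∞} (hφ : Measurable φ) (hφ1 : ∀ y, φ y ≤ 1) :
    n.factorial * ∫⁻ y, φ y ∂(A.reports ⊥ ρ) ≤
      ∑ σ : Equiv.Perm (Fin n), ∫⁻ y, φ y ∂(A.reports (H.comap σ) ρ) +
        ENNReal.ofReal (n.factorial * (1 / 4)) := by
  have main : ∃ b : Equiv.Perm (Fin n) → ℝ, (∀ σ, 0 ≤ b σ) ∧
      (∀ σ : Equiv.Perm (Fin n), ∫⁻ y, φ y ∂(A.reports ⊥ ρ) ≤
        ∫⁻ y, φ y ∂(A.reports (H.comap σ) ρ) + ENNReal.ofReal (b σ)) ∧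
      ∑ σ, b σ ≤ n.factorial * (1 / 4) := by
    -- With `t = 1 / 20` and average cost at most `2 / 300`, the averaged loss is at most `2 / 15 +
    -- 1 / 10 < 1 / 4`. If `2 * d > n`, group privacy over all nodes suffices, as `3 * n * ε ≤ 6 /
    -- 1000`.
    by_cases h2d : 2 * d ≤ n
    · refine ⟨fun σ => (∑ i, A.reportCost ρ i ((H.comap σ).neighborSet i)) / (1 / 20)
        + 2 * (1 / 20), fun σ => ?_, fun σ => ?_, ?_⟩
      · have : 0 ≤ ∑ i, A.reportCost ρ i ((H.comap σ).neighborSet i) :=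
          Finset.sum_nonneg fun i _ => reportCost_nonneg _ _ _
        positivity
      · rw [reports_bot]
        refine (lintegral_pi_le _ (fun i => A.randomizer i ((H.comap σ).neighborSet i) ρ)
          (t := 1 / 20) (by norm_num) hφ hφ1).trans ?_
        have := one_sub_prod_affinity_le (fun i => A.randomizer i ∅ ρ)
          (fun i => A.randomizer i ((H.comap σ).neighborSet i) ρ)
        refine add_le_add le_rfl (ENNReal.ofReal_le_ofReal ?_)
        beta_reduce
        gcongr
        exact this
      · rw [Finset.sum_add_distrib, ← Finset.sum_div, Finset.sum_const, Finset.card_univ,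
          Fintype.card_perm, Fintype.card_fin, nsmul_eq_mul]
        have := sum_perm_neighborSet_le (reportCost_nonneg ρ) hn h2d
          (hA.sum_reportCost_le hε hε1 hδ hδε ρ hd) hH
        have hf : (0 : ℝ) ≤ n.factorial := by positivity
        linarith
    · refine ⟨fun _ => 1 / 4, fun _ => by norm_num, fun σ => ?_, ?_⟩
      · have h2d' : (n : ℝ) ≤ 2 * d := by
          have : n ≤ 2 * d := by omega
          exact_mod_cast this
        have h1 : ∀ S, MeasurableSet S → (Measure.pi fun i => A.randomizer i ∅ ρ).real S ≤
            (Measure.pi fun i => A.randomizer i ((H.comap σ).neighborSet i) ρ).real S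
              + 6 / 1000 := by
          intro S hS
          have := hA.measureReal_reports_le hε hε1 hδ hδε ρ Finset.univ ⊥ (H.comap σ)
            (fun u _ hu => absurd (Finset.mem_univ u) hu) S hS
          rw [reports_bot, Finset.card_univ, Fintype.card_fin] at this
          change _ ≤ (Measure.pi fun i =>
            A.randomizer i ((H.comap σ).neighborSet i) ρ).real S + _ at this
          nlinarith
        have h2 := one_sub_le_prod_affinity _ _ h1
        rw [reports_bot]
        refine (lintegral_pi_le _ (fun i => A.randomizer i ((H.comap σ).neighborSet i) ρ)
          (t := 1 / 20) (by norm_num) hφ hφ1).trans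
          (add_le_add le_rfl (ENNReal.ofReal_le_ofReal ?_))
        linarith
      · rw [Finset.sum_const, Finset.card_univ, Fintype.card_perm, Fintype.card_fin,
          nsmul_eq_mul]
  obtain ⟨b, hb0, hb, hbs⟩ := main
  calc n.factorial * ∫⁻ y, φ y ∂(A.reports ⊥ ρ)
      = ∑ σ : Equiv.Perm (Fin n), ∫⁻ y, φ y ∂(A.reports ⊥ ρ) := by
        rw [Finset.sum_const, Finset.card_univ, Fintype.card_perm, Fintype.card_fin,
          nsmul_eq_mul]
    _ ≤ ∑ σ : Equiv.Perm (Fin n),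
          (∫⁻ y, φ y ∂(A.reports (H.comap σ) ρ) + ENNReal.ofReal (b σ)) :=
        Finset.sum_le_sum fun σ _ => hb σ
    _ ≤ _ := by
        rw [Finset.sum_add_distrib, ← ENNReal.ofReal_sum_of_nonneg fun σ _ => hb0 σ]
        gcongr

/-! ### From reports to outputs and the error bound -/

theorem output_apply (A : LocalAlgorithm.{u, v} n) (G : SimpleGraph (Fin n)) {E : Set ℝ}
    (hE : MeasurableSet E) :
    A.output G E = ∫⁻ ρ, ∫⁻ y, A.post y E ∂(A.reports G ρ) ∂A.publicDist := by
  rw [output, Measure.bind_apply hE A.post.measurable.aemeasurable,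
    Measure.lintegral_bind (A.reports G).measurable.aemeasurable
      (A.post.measurable_coe hE).aemeasurable]

instance (A : LocalAlgorithm.{u, v} n) (G : SimpleGraph (Fin n)) :
    IsProbabilityMeasure (A.output G) := by
  constructor
  rw [output_apply _ _ MeasurableSet.univ]
  simp

theorem IsLNDP.sum_perm_output_le (hA : A.IsLNDP ε δ) (hε : 0 ≤ ε) (hε1 : ε ≤ 1)
    (hδ : 0 ≤ δ) (hδε : δ ≤ ε) {d : ℕ} (hn : 0 < n)
    (hd : d * ε ≤ 1 / 1000) {H : SimpleGraph (Fin n)} (hH : DegreeBounded d H)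
    {E : Set ℝ} (hE : MeasurableSet E) :
    n.factorial * A.output ⊥ E ≤
      ∑ σ : Equiv.Perm (Fin n), A.output (H.comap σ) E +
        ENNReal.ofReal (n.factorial * (1 / 4)) := by
  have hm : ∀ G, Measurable fun ρ => ∫⁻ y, A.post y E ∂(A.reports G ρ) := fun G =>
    (A.post.measurable_coe hE).lintegral_kernel
  simp only [output_apply _ _ hE]
  rw [← lintegral_const_mul _ (hm ⊥), ← lintegral_finsetSum _ fun σ _ => hm _]
  calc _ ≤ ∫⁻ ρ, (∑ σ : Equiv.Perm (Fin n), ∫⁻ y, A.post y E ∂(A.reports (H.comap σ) ρ) +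
        ENNReal.ofReal (n.factorial * (1 / 4))) ∂A.publicDist :=
      lintegral_mono fun ρ => hA.sum_perm_lintegral_le hε hε1 hδ hδε ρ hn hd hH
        (A.post.measurable_coe hE) fun y => prob_le_one
    _ = _ := by
      rw [lintegral_add_right _ measurable_const, lintegral_const, measure_univ, mul_one]

theorem degreeBounded_comap {d : ℕ} {H : SimpleGraph (Fin n)} (hH : DegreeBounded d H)
    (σ : Equiv.Perm (Fin n)) : DegreeBounded d (H.comap σ) := by
  intro v
  refine le_trans (Set.ncard_le_ncard_of_injOn σ (t := H.neighborSet (σ v)) ?_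
    σ.injective.injOn (Set.toFinite _)) (hH (σ v))
  intro w hw
  simpa using hw

theorem ncard_edgeSet_comap (H : SimpleGraph (Fin n)) (σ : Equiv.Perm (Fin n)) :
    (H.comap σ).edgeSet.ncard = H.edgeSet.ncard :=
  Nat.card_congr (SimpleGraph.Iso.comap σ H).mapEdgeSet

/-- No private algorithm counts the edges of graphs of bounded degree with an error below half of
the number of edges of some such graph. -/
theorem IsLNDP.ncard_edgeSet_le (hA : A.IsLNDP ε δ) (hε : 0 ≤ ε) (hε1 : ε ≤ 1)
    (hδ : 0 ≤ δ) (hδε : δ ≤ ε) {d : ℕ} (hn : 0 < n) (hd : d * ε ≤ 1 / 1000)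
    {H : SimpleGraph (Fin n)} (hH : DegreeBounded d H) {α : ℝ} (hα : A.CountsEdges d α) :
    (H.edgeSet.ncard : ℝ) ≤ 2 * α := by
  by_contra! hlt
  let E : Set ℝ := {x | |x| ≤ α}
  have hE : MeasurableSet E := measurableSet_le (by fun_prop) measurable_const
  have h0 : 2 / 3 ≤ A.output ⊥ E := by
    have := hα ⊥ (fun v => by simp)
    simpa [E] using this
  have h1 : ∀ σ : Equiv.Perm (Fin n), A.output (H.comap σ) E ≤ 1 / 3 := by
    intro σ
    have h := hα (H.comap σ) (degreeBounded_comap hH σ)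
    rw [ncard_edgeSet_comap] at h
    -- The accuracy windows around `0` and around the number of edges are disjoint.
    have hsub : {x : ℝ | |x - (H.edgeSet.ncard : ℝ)| ≤ α} ⊆ Eᶜ := by
      intro x hx hxE
      have hx1 := abs_le.1 (show |x - (H.edgeSet.ncard : ℝ)| ≤ α from hx)
      have hx2 := abs_le.1 (show |x| ≤ α from hxE)
      linarith [hx1.1, hx2.2]
    have h2 := h.trans (measure_mono hsub)
    have h3 : A.output (H.comap σ) E + A.output (H.comap σ) Eᶜ = 1 := by
      rw [measure_add_measure_compl hE, measure_univ]
    have h4 : A.output (H.comap σ) E + 2 / 3 ≤ 1 / 3 + 2 / 3 := by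
      calc _ ≤ A.output (H.comap σ) E + A.output (H.comap σ) Eᶜ := by gcongr
        _ = 1 := h3
        _ = 1 / 3 + 2 / 3 := by
          rw [ENNReal.div_add_div_same, show (1 + 2 : ℝ≥0∞) = 3 by norm_num]
          exact (ENNReal.div_self (by norm_num) (by norm_num)).symm
    exact (ENNReal.add_le_add_iff_right (by finiteness)).1 h4
  have h2 := hA.sum_perm_output_le hε hε1 hδ hδε hn hd hH hE
  have h3 : (n.factorial : ℝ≥0∞) * (2 / 3) ≤
      n.factorial * (1 / 3) + ENNReal.ofReal (n.factorial * (1 / 4)) := by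
    calc (n.factorial : ℝ≥0∞) * (2 / 3) ≤ n.factorial * A.output ⊥ E := by gcongr
      _ ≤ _ := h2
      _ ≤ ∑ σ : Equiv.Perm (Fin n), (1 / 3 : ℝ≥0∞) +
            ENNReal.ofReal (n.factorial * (1 / 4)) := by
          gcongr with σ
          exact h1 σ
      _ = _ := by
          rw [Finset.sum_const, Finset.card_univ, Fintype.card_perm, Fintype.card_fin,
            nsmul_eq_mul]
  -- After division by `n.factorial` this reads `2 / 3 ≤ 1 / 3 + 1 / 4`, which is false.
  have h4 := ENNReal.toReal_mono (by finiteness) h3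
  rw [ENNReal.toReal_add (by finiteness) (by finiteness),
    ENNReal.toReal_ofReal (by positivity)] at h4
  simp only [ENNReal.toReal_mul, ENNReal.toReal_natCast, ENNReal.toReal_div,
    ENNReal.toReal_ofNat, ENNReal.toReal_one] at h4
  have hf : (0 : ℝ) < n.factorial := by exact_mod_cast n.factorial_pos
  linarith

theorem IsLNDP.le_error (hA : A.IsLNDP ε δ) (hε : 0 ≤ ε) (hε1 : ε ≤ 1)
    (hδ : 0 ≤ δ) (hδε : δ ≤ ε) {d : ℕ} (hn : 0 < n) (hd : d * ε ≤ 1 / 1000)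
    {α : ℝ} (hα : A.CountsEdges d α) :
    1 / 2 * min (⌊(d : ℝ) * n / 2⌋₊ : ℝ) (n.choose 2 : ℝ) ≤ α := by
  have hfloor : ⌊(d : ℝ) * n / 2⌋₊ = d * n / 2 := by
    rw [← Nat.cast_mul]
    exact (Nat.floor_div_ofNat _ 2).trans (by rw [Nat.floor_natCast])
  rw [hfloor]
  by_cases hdn : d < n
  · have h1 := hA.ncard_edgeSet_le hε hε1 hδ hδε hn hd (degreeBounded_nearRegularGraph hdn) hα
    have h2 : ((d * n / 2 : ℕ) : ℝ) ≤ ((nearRegularGraph n d).edgeSet.ncard : ℝ) := by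
      exact_mod_cast le_ncard_edgeSet_nearRegularGraph hdn
    have h3 := min_le_left ((d * n / 2 : ℕ) : ℝ) (n.choose 2 : ℝ)
    linarith
  -- For `d ≥ n` the degree bound is vacuous, and degree parameter `n - 1` already yields all
  -- `n.choose 2` edges.
  · have hlt : n - 1 < n := by omega
    have hH : DegreeBounded d (nearRegularGraph n (n - 1)) := fun v =>
      (degreeBounded_nearRegularGraph hlt v).trans (by omega)
    have h1 := hA.ncard_edgeSet_le hε hε1 hδ hδε hn hd hH hα
    have h2 : ((n.choose 2 : ℕ) : ℝ) ≤
        ((nearRegularGraph n (n - 1)).edgeSet.ncard : ℝ) := by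
      have := le_ncard_edgeSet_nearRegularGraph hlt
      rw [mul_comm, ← Nat.choose_two_right] at this
      exact_mod_cast this
    have h3 := min_le_right ((d * n / 2 : ℕ) : ℝ) (n.choose 2 : ℝ)
    linarith

end LocalAlgorithm

theorem mainTheorem6 :
    ∃ c : ℝ, 0 < c ∧ ∃ c' : ℝ, 0 < c' ∧ ∃ n₀ : ℕ,
      ∀ ε δ : ℝ, 0 < ε → 0 ≤ δ → δ ≤ ε → ε ≤ c →
      ∀ n : ℕ, n₀ ≤ n →
      ∀ A : LocalAlgorithm.{u, v} n, A.IsLNDP ε δ →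
      ∀ α : ℝ,
        (∀ d : ℕ, 1 ≤ d → (d : ℝ) ≤ c / ε → A.CountsEdges d α →
          1 / 2 * min (⌊(d : ℝ) * n / 2⌋₊ : ℝ) (n.choose 2 : ℝ) ≤ α) ∧
        (A.CountsEdges ⌊min (c / ε) ((n : ℝ) - 1)⌋₊ α →
          c' * min (n / ε) ((n : ℝ) ^ 2) ≤ α) := by
  -- The value `n₀ = 2` gives `x ≥ 1`, so `d ≥ 1` and `d ≥ x / 2`. Then `α ≥ d * n / 8 ≥ n * x /
  -- 16`, where `n * x` is at least `1 / 1000` of the minimum; `1 / 32000` leaves a spare factor 2.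
  refine ⟨1 / 1000, by norm_num, 1 / 32000, by norm_num, 2, ?_⟩
  intro ε δ hε hδ hδε hεc n hn A hA α
  have hε1 : ε ≤ 1 := by linarith
  have hn2 : (2 : ℝ) ≤ n := by exact_mod_cast hn
  refine ⟨fun d _ hd hα => hA.le_error hε.le hε1 hδ hδε (by omega)
    ((le_div_iff₀ hε).1 hd) hα, fun hα => ?_⟩
  set x : ℝ := min (1 / 1000 / ε) ((n : ℝ) - 1) with hx
  have hx1 : 1 ≤ x := le_min ((one_le_div hε).2 hεc) (by linarith)
  set d : ℕ := ⌊x⌋₊ with hd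
  have hdx : (d : ℝ) ≤ x := Nat.floor_le (by linarith)
  have hxd : x < d + 1 := Nat.lt_floor_add_one x
  have hd1 : (1 : ℝ) ≤ d := by
    have : 1 ≤ d := Nat.le_floor (by simpa using hx1)
    exact_mod_cast this
  have h1 := hA.le_error hε.le hε1 hδ hδε (by omega)
    ((le_div_iff₀ hε).1 (hdx.trans (min_le_left _ _))) hα
  have h2 : (d : ℝ) * n / 4 ≤ min (⌊(d : ℝ) * n / 2⌋₊ : ℝ) (n.choose 2 : ℝ) := by
    refine le_min ?_ ?_
    · have hfl := Nat.lt_floor_add_one ((d : ℝ) * n / 2)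
      have hfl1 : 1 ≤ ⌊(d : ℝ) * n / 2⌋₊ := Nat.le_floor (by push_cast; nlinarith)
      have hfl2 : (1 : ℝ) ≤ (⌊(d : ℝ) * n / 2⌋₊ : ℝ) := by exact_mod_cast hfl1
      linarith
    · rw [Nat.cast_choose_two]
      have := hdx.trans (min_le_right _ _)
      nlinarith
  have h3 : 1 / 1000 * min (n / ε) ((n : ℝ) ^ 2) ≤ n * x := by
    rw [hx]
    rcases min_choice (1 / 1000 / ε) ((n : ℝ) - 1) with h | h <;> rw [h]
    · calc 1 / 1000 * min (n / ε) ((n : ℝ) ^ 2) ≤ 1 / 1000 * (n / ε) := by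
            gcongr
            exact min_le_left _ _
        _ = n * (1 / 1000 / ε) := by ring
    · have := min_le_right (n / ε) ((n : ℝ) ^ 2)
      nlinarith
  nlinarith
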